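/- **Conventions.** A skew left brace is a set $B$ with two group structures $(B,\star)$ and $(B,\cdot)$ such that $a\cdot(b\star c)=(a\cdot b)\star a^{\star}\star(a\cdot c)$ for all $a,b,c$, where $a^\star$ is the inverse of $a$ in $(B,\star)$; both groups have the same identity $1$. Put $\lambda_a(b)=a^\star\star(a\cdot b)$; this defines an action $\lambda:(B,\cdot)\to\operatorname{Aut}(B,\star)$. Let $G=(B,\star)\rtimes(B,\cdot)$ be the semidirect product with respect to $\lambda$, so $(a,b)(a',b')=(a\star\lambda_b(a'),\,b\cdot b')$. It acts on $B$ by $\Theta_{(a,b)}(c)=a\star\lambda_b(c)\star a^\star$; $\operatorname{St}(a)\le G$ is the stabilizer of $a\in B$ for this action. A non-degenerate solution is a pair $(X,r)$ with $X$ a non-empty set and $r:X\times X\to X\times X$ a bijection, written $r(x,y)=(f_x(y),g_y(x))$, such that $(r\times\mathrm{id})(\mathrm{id}\times r)(r\times\mathrm{id})=(\mathrm{id}\times r)(r\times\mathrm{id})(\mathrm{id}\times r)$ and all $f_x$, $g_y$ are bijective. An isomorphism $(X,r)\to(Y,s)$ is a bijection $F:X\to Y$ with $s\circ(F\times F)=(F\times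 F)\circ r$. The structure group is $G(X,r)=\langle X\mid x\cdot y=f_x(y)\cdot g_y(x)\rangle$ and the derived group is $A(X,r)=\langle X\mid x\star f_x(y)=f_x(y)\star f_{f_x(y)}g_y(x)\rangle$. The maps $f_x$ induce an action $\lambda:G(X,r)\to\operatorname{Aut}(A(X,r))$, and there is a unique map $\varphi:G(X,r)\to A(X,r)$ with $\varphi(x)=x$ for $x\in X$ and $\varphi(ab)=\varphi(a)\star\lambda_a(\varphi(b))$; it is bijective, and transporting the product of $A(X,r)$ along $\varphi$ makes $G(X,r)$ a skew left brace. With $\tilde g_x(z)=g_{f_z^{-1}(x)}(z)$, the permutation group is $\mathcal G(X,r)=\langle (f_x,\tilde g_x^{-1}) : x\in X\rangle\le\operatorname{Sym}_X\times\operatorname{Sym}_X$; it is a skew left brace as the quotient of $G(X,r)$ under $x\mapsto(f_x,\tilde g_x^{-1})$. **Theorem.** Let $B$ be a skew left brace, let $\mathcal O$ be the set of orbits of $\Theta$ on $B$, and choose an element $a_i\in i$ for each $i\in\mathcal O$. (1) Let $I\subseteq\mathcal O$ be a non-empty set of orbits such that $\bigcup_{i\in I}i$ generates $(B,\star)$.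 For each $i\in I$ let $J_i$ be a non-empty set and let $(K_{i,j})_{j\in J_i}$ be a family of subgroups of $\operatorname{St}(a_i)$, such that $$\Big\{a\in B:(1,a),(a,a)\in\bigcap_{i\in I}\bigcap_{j\in J_i}\operatorname{core}_G(K_{i,j})\Big\}=\{1\}.$$ Let $X=\bigsqcup_{i\in I}\bigsqcup_{j\in J_i}G/K_{i,j}$ be the disjoint union of the sets of left cosets, and define $r(x,y)=(f_x(y),g_y(x))$ for $x=(b_1,c_1)K_{i_1,j_1}$, $y=(b_2,c_2)K_{i_2,j_2}$ by $$f_x(y)=(1,\Theta_{(b_1,c_1)}(a_{i_1}))\,(b_2,c_2)K_{i_2,j_2},\qquad g_y(x)=(w,w)^{-1}(b_1,c_1)K_{i_1,j_1},$$ where $w=\Theta_{(1,\Theta_{(b_1,c_1)}(a_{i_1}))}\Theta_{(b_2,c_2)}(a_{i_2})$. Then $r$ is well defined, $(X,r)$ is a non-degenerate solution, and $\mathcal G(X,r)\cong B$ as skew left braces. (2) Every non-degenerate solution $(Z,t)$ with $\mathcal G(Z,t)\cong B$ as skew left braces is isomorphic to a solution $(X,r)$ as in (1), for the given choice of the $a_i$.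 -/

import Mathlib

universe u v w

/-! ### Skew left braces -/

/-- A skew left brace: a type with two group structures, the multiplicative group `(B, ·)`, written
with `*`, `⁻¹`, `1`, and the star group `(B, ⋆)`, written additively with `+`, `-`, `0`
(Mathlib's `AddGroup` is not assumed to be commutative), such that
`a · (b ⋆ c) = (a · b) ⋆ a^⋆ ⋆ (a · c)`. -/
class SkewLeftBrace (B : Type u) extends Group B, AddGroup B where
  mul_star : ∀ a b c : B, a * (b + c) = a * b + -a + a * c

namespace SkewLeftBrace

section

variable {B : Type u} [SkewLeftBrace B]

/-- The two groups have the same identity element. -/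
theorem zero_eq_one : (0 : B) = 1 := by
  have h := mul_star (1 : B) 0 0
  rw [add_zero, one_mul, zero_add, add_zero] at h
  exact (neg_eq_zero.1 h.symm).symm

theorem mul_zero_eq (a : B) : a * 0 = a := by rw [zero_eq_one, mul_one]

theorem mul_neg_eq (a b : B) : a * -b = a + -(a * b) + a := by
  have h := mul_star a b (-b)
  rw [add_neg_cancel, mul_zero_eq] at h
  have h2 : a * -b = -(a * b + -a) + a := by
    rw [eq_neg_add_iff_add_eq]; exact h.symm
  rw [h2, neg_add_rev, neg_neg]

/-- `λ_a` as an automorphism of the star group: `λ_a(b) = a^⋆ ⋆ (a · b)`. The star group is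
`Multiplicative B`, that is, the additive group of `B` written multiplicatively. -/
def lam (a : B) : MulAut (Multiplicative B) where
  toFun b := Multiplicative.ofAdd (-a + a * b.toAdd)
  invFun b := Multiplicative.ofAdd (-a⁻¹ + a⁻¹ * b.toAdd)
  left_inv b := by
    apply Multiplicative.toAdd.injective
    simp [mul_star, mul_neg_eq, ← zero_eq_one, add_assoc]
  right_inv b := by
    apply Multiplicative.toAdd.injective
    simp [mul_star, mul_neg_eq, ← zero_eq_one, add_assoc]
  map_mul' b c := by
    apply Multiplicative.toAdd.injective
    simp [mul_star, add_assoc]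

/-- The action `λ : (B, ·) → Aut(B, ⋆)`. -/
def lamHom (B : Type u) [SkewLeftBrace B] : B →* MulAut (Multiplicative B) :=
  MonoidHom.mk' lam fun a b => by
    ext c
    apply Multiplicative.toAdd.injective
    simp [lam, mul_star, mul_neg_eq, mul_assoc, add_assoc]

end

/-- The group `(B, ⋆) ⋊ (B, ·)` with respect to `λ`; its product is
`(a, b)(a', b') = (a ⋆ λ_b(a'), b · b')`. -/
abbrev SemiProd (B : Type u) [SkewLeftBrace B] : Type u := Multiplicative B ⋊[lamHom B] B

/-- The element `(a, b)` of `(B, ⋆) ⋊ (B, ·)`. -/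
def pair {B : Type u} [SkewLeftBrace B] (a b : B) : SemiProd B := ⟨Multiplicative.ofAdd a, b⟩

/-- The morphism `Θ : (B, ⋆) ⋊ (B, ·) → Aut(B, ⋆)`, `Θ_{(a,b)}(c) = a ⋆ λ_b(c) ⋆ a^⋆`. -/
def Theta (B : Type u) [SkewLeftBrace B] : SemiProd B →* MulAut (Multiplicative B) :=
  MonoidHom.mk' (fun g => MulAut.conj g.left * lamHom B g.right) fun g h => by
    ext c
    simp [mul_assoc]

/-- The group `(B, ⋆) ⋊ (B, ·)` acts on `B` through `Θ`. -/
instance thetaAction (B : Type u) [SkewLeftBrace B] : MulAction (SemiProd B) B where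
  smul g c := (Theta B g (Multiplicative.ofAdd c)).toAdd
  one_smul c := by
    change (Theta B 1 (Multiplicative.ofAdd c)).toAdd = c
    simp
  mul_smul g h c := by
    change (Theta B (g * h) (Multiplicative.ofAdd c)).toAdd =
      (Theta B g (Multiplicative.ofAdd (Theta B h (Multiplicative.ofAdd c)).toAdd)).toAdd
    simp

theorem pair_mul_pair {B : Type u} [SkewLeftBrace B] (a b a' b' : B) :
    pair a b * pair a' b' = pair (a + (-b + b * a')) (b * b') := rfl

theorem pair_smul {B : Type u} [SkewLeftBrace B] (a b c : B) :
    pair a b • c = a + (-b + b * c) + -a := rfl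

/-- The set `𝒪` of orbits of `Θ`. -/
abbrev Orbits (B : Type u) [SkewLeftBrace B] : Type u :=
  MulAction.orbitRel.Quotient (SemiProd B) B

end SkewLeftBrace

/-! ### Non-degenerate set-theoretic solutions of the Yang-Baxter equation -/

namespace YangBaxter

/-- `r × id` on `X × X × X`. -/
def onLeft {X : Type v} (r : X × X → X × X) : X × X × X → X × X × X :=
  fun p => ((r (p.1, p.2.1)).1, (r (p.1, p.2.1)).2, p.2.2)

/-- `id × r` on `X × X × X`. -/
def onRight {X : Type v} (r : X × X → X × X) : X × X × X → X × X × X :=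
  fun p => (p.1, r p.2)

/-- Set-theoretic solutions of the Yang-Baxter equation. -/
structure IsSolution {X : Type v} (r : X × X → X × X) : Prop where
  nonempty : Nonempty X
  bijective : Function.Bijective r
  braid : onLeft r ∘ onRight r ∘ onLeft r = onRight r ∘ onLeft r ∘ onRight r

/-- With `r (x, y) = (f_x(y), g_y(x))`, a solution is non-degenerate if all the maps `f_x` and
`g_y` are bijective. -/
structure IsNonDegenerate {X : Type v} (r : X × X → X × X) : Prop extends IsSolution r where
  f_bijective : ∀ x, Function.Bijective fun y => (r (x, y)).1
  g_bijective : ∀ y, Function.Bijective fun x => (r (x, y)).2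

/-- Two solutions are isomorphic if there is a bijection `F` with `s ∘ (F × F) = (F × F) ∘ r`. -/
def Isomorphic {X : Type v} {Y : Type w} (r : X × X → X × X) (s : Y × Y → Y × Y) : Prop :=
  ∃ F : X ≃ Y, ∀ x₁ x₂, s (F x₁, F x₂) = Prod.map F F (r (x₁, x₂))

section

variable {X : Type v} {r : X × X → X × X} (h : IsNonDegenerate r)

/-- The permutation `f_x`. -/
noncomputable def f (x : X) : Equiv.Perm X := Equiv.ofBijective _ (h.f_bijective x)

/-- The permutation `g_y`. -/
noncomputable def g (y : X) : Equiv.Perm X := Equiv.ofBijective _ (h.g_bijective y)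

theorem perm_inv_apply_self (s : Equiv.Perm X) (x : X) : s⁻¹ (s x) = x := s.symm_apply_apply x

theorem perm_apply_inv_self (s : Equiv.Perm X) (x : X) : s (s⁻¹ x) = x := s.apply_symm_apply x

theorem r_eq (x y : X) : r (x, y) = (f h x y, g h y x) := rfl

theorem braid_apply (x y z : X) :
    f h (f h x y) (f h (g h y x) z) = f h x (f h y z) ∧
    g h (f h (g h y x) z) (f h x y) = f h (g h (f h y z) x) (g h z y) ∧
    g h z (g h y x) = g h (g h z y) (g h (f h y z) x) := by
  have := congrFun h.braid (x, y, z)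
  simpa [onLeft, onRight, r_eq h] using this

theorem f_mul (x y : X) : f h x * f h y = f h (f h x y) * f h (g h y x) := by
  ext z; exact (braid_apply h x y z).1.symm

theorem gt_bijective (u : X) : Function.Bijective fun x => g h ((f h x)⁻¹ u) x := by
  constructor
  · intro x x' e
    have : r (x, (f h x)⁻¹ u) = r (x', (f h x')⁻¹ u) := by
      rw [r_eq h, r_eq h]
      simpa using e
    exact congrArg Prod.fst (h.bijective.1 this)
  · intro z
    obtain ⟨⟨x, y⟩, e⟩ := h.bijective.2 (u, z)
    rw [r_eq h, Prod.mk.injEq] at e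
    refine ⟨x, ?_⟩
    change g h ((f h x)⁻¹ u) x = z
    rw [← e.1, perm_inv_apply_self, e.2]

/-- The permutation `g̃_u` for `u` in `X`: the formula `g̃_b(x) = g_{λ_x⁻¹(b)}(x)`, at
the generator `b = u` of the structure group, where `λ_x⁻¹(u) = f_x⁻¹(u)`. -/
noncomputable def gt (u : X) : Equiv.Perm X := Equiv.ofBijective _ (gt_bijective h u)

theorem gt_apply (u x : X) : gt h u x = g h ((f h x)⁻¹ u) x := rfl

theorem gt_f (x y : X) : gt h (f h x y) x = g h y x := by simp [gt_apply]

theorem gt_mul (x y : X) : gt h y * gt h x = gt h (g h y x) * gt h (f h x y) := by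
  ext t
  obtain ⟨s, rfl⟩ := (f h t).surjective x
  obtain ⟨q, rfl⟩ := (f h (g h s t)).surjective y
  have b1 := (braid_apply h t s q).1
  have b2 := (braid_apply h t s q).2.1
  have b3 := (braid_apply h t s q).2.2
  simp only [Equiv.Perm.mul_apply]
  rw [gt_f, gt_f, b1, gt_f, b2, gt_f, b3]

/-- The permutation `x ↦ x ◁ u` of the derived rack: `x ◁ f_x(y) = f_{f_x(y)} g_y(x)`. -/
noncomputable def der (u : X) : Equiv.Perm X := f h u * gt h u

theorem der_f (x y : X) : der h (f h x y) x = f h (f h x y) (g h y x) := by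
  simp [der, gt_f]

theorem f_der (z u x : X) : f h z (der h u x) = der h (f h z u) (f h z x) := by
  obtain ⟨y, rfl⟩ := (f h x).surjective u
  have b1 := (braid_apply h z x y).1
  have b2 := (braid_apply h z x y).2.1
  rw [der_f, ← (braid_apply h z (f h x y) (g h y x)).1, ← b2, ← b1, der_f]

theorem f_mul_der (z u : X) : f h z * der h u = der h (f h z u) * f h z := by
  ext x; exact f_der h z u x

theorem der_mul_der (u x : X) : der h u * der h x = der h (der h u x) * der h u := by
  obtain ⟨y, rfl⟩ := (f h x).surjective u
  have e1 : der h (f h x y) * der h x = f h x * (der h y * gt h x) := by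
    rw [← mul_assoc, f_mul_der, der, mul_assoc, ← der]; rfl
  rw [e1, der_f, show der h (f h x y) = f h (f h x y) * gt h (f h x y) from rfl,
    ← mul_assoc (der h _), ← f_mul_der, der, der]
  rw [show f h x * (f h y * gt h y * gt h x) = (f h x * f h y) * (gt h y * gt h x) by group,
    f_mul, gt_mul]
  group

theorem T_bijective : Function.Bijective fun x => (f h x)⁻¹ x := by
  constructor
  · have key : ∀ x y, (f h x)⁻¹ x = y → x = (g h y)⁻¹ (f h y (gt h y y)) := by
      intro w y e
      have e : f h w y = w := by rw [← e, perm_apply_inv_self]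
      have c1 := f_mul h w y
      rw [e] at c1
      have c1 := mul_left_cancel c1
      obtain ⟨q, hq⟩ := (f h y).surjective y
      have b2 := (braid_apply h w y q).2.1
      rw [← c1, hq, e, ← c1] at b2
      have hg : gt h y y = g h q y := by
        rw [gt_apply]; congr 2
        rw [Equiv.Perm.inv_eq_iff_eq, hq]
      rw [hg, ← b2, perm_inv_apply_self]
    intro x x' e
    rw [key x _ rfl, key x' _ rfl]
    simp only at e
    rw [e]
  · intro y
    obtain ⟨t, ht⟩ := (g h y).surjective y
    have c1 := f_mul h t y
    rw [ht] at c1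
    refine ⟨f h t y, ?_⟩
    change (f h (f h t y))⁻¹ (f h t y) = y
    rw [← mul_right_cancel c1, perm_inv_apply_self]

/-- Defining relators of the structure group: `x · y = f_x(y) · g_y(x)`. -/
def structureRels : Set (FreeGroup X) :=
  {w | ∃ x y : X, w = FreeGroup.of x * FreeGroup.of y *
    (FreeGroup.of (f h x y) * FreeGroup.of (g h y x))⁻¹}

/-- Defining relators of the derived group: `x ⋆ f_x(y) = f_x(y) ⋆ f_{f_x(y)} g_y(x)`. -/
def derivedRels : Set (FreeGroup X) :=
  {w | ∃ x y : X, w = FreeGroup.of x * FreeGroup.of (f h x y) *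
    (FreeGroup.of (f h x y) * FreeGroup.of (f h (f h x y) (g h y x)))⁻¹}

/-- The structure group `G(X, r)`. -/
abbrev StructureGroup : Type v := PresentedGroup (structureRels h)

/-- The derived group `A(X, r)`, written multiplicatively. -/
abbrev DerivedGroup : Type v := PresentedGroup (derivedRels h)

/-- The natural map `i_G : X → G(X, r)`. -/
def iG (x : X) : StructureGroup h := PresentedGroup.of x

/-- The natural map `i_A : X → A(X, r)`. -/
def iA (x : X) : DerivedGroup h := PresentedGroup.of x

theorem iG_mul (x y : X) : iG h x * iG h y = iG h (f h x y) * iG h (g h y x) :=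
  PresentedGroup.mk_eq_mk_of_mul_inv_mem (x := FreeGroup.of x * FreeGroup.of y)
    (y := FreeGroup.of (f h x y) * FreeGroup.of (g h y x)) ⟨x, y, rfl⟩

theorem iA_mul (x u : X) : iA h x * iA h u = iA h u * iA h (der h u x) := by
  obtain ⟨y, rfl⟩ := (f h x).surjective u
  rw [der_f]
  exact PresentedGroup.mk_eq_mk_of_mul_inv_mem (x := FreeGroup.of x * FreeGroup.of (f h x y))
    (y := FreeGroup.of (f h x y) * FreeGroup.of (f h (f h x y) (g h y x))) ⟨x, y, rfl⟩

/-- Universal property of `G(X, r)`. -/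
def liftG {H : Type w} [Group H] (k : X → H)
    (hk : ∀ x y, k x * k y = k (f h x y) * k (g h y x)) : StructureGroup h →* H :=
  PresentedGroup.toGroup (f := k) (by
    rintro _ ⟨x, y, rfl⟩
    simp only [map_mul, map_inv, FreeGroup.lift_apply_of]
    rw [hk, mul_inv_cancel])

/-- Universal property of `A(X, r)`. -/
def liftA {H : Type w} [Group H] (k : X → H)
    (hk : ∀ x u, k x * k u = k u * k (der h u x)) : DerivedGroup h →* H :=
  PresentedGroup.toGroup (f := k) (by
    rintro _ ⟨x, y, rfl⟩
    simp only [map_mul, map_inv, FreeGroup.lift_apply_of]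
    rw [hk, der_f, mul_inv_cancel])

theorem liftG_iG {H : Type w} [Group H] (k : X → H) (hk) (x : X) :
    liftG h k hk (iG h x) = k x := PresentedGroup.toGroup.of _

theorem liftA_iA {H : Type w} [Group H] (k : X → H) (hk) (x : X) :
    liftA h k hk (iA h x) = k x := PresentedGroup.toGroup.of _

theorem homG_ext {H : Type w} [Group H] {k l : StructureGroup h →* H}
    (e : ∀ x, k (iG h x) = l (iG h x)) : k = l := PresentedGroup.ext e

theorem homA_ext {H : Type w} [Group H] {k l : DerivedGroup h →* H}
    (e : ∀ x, k (iA h x) = l (iA h x)) : k = l := PresentedGroup.ext e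

@[elab_as_elim]
theorem inductionG {P : StructureGroup h → Prop} (hi : ∀ x, P (iG h x)) (h1 : P 1)
    (hm : ∀ a b, P a → P b → P (a * b)) (hinv : ∀ a, P a → P a⁻¹) (a : StructureGroup h) : P a :=
  PresentedGroup.generated_by (structureRels h)
    { carrier := {a | P a}, mul_mem' := fun ha hb => hm _ _ ha hb, one_mem' := h1,
      inv_mem' := fun ha => hinv _ ha } hi a

@[elab_as_elim]
theorem inductionA {P : DerivedGroup h → Prop} (hi : ∀ x, P (iA h x)) (h1 : P 1)
    (hm : ∀ a b, P a → P b → P (a * b)) (hinv : ∀ a, P a → P a⁻¹) (a : DerivedGroup h) : P a :=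
  PresentedGroup.generated_by (derivedRels h)
    { carrier := {a | P a}, mul_mem' := fun ha hb => hm _ _ ha hb, one_mem' := h1,
      inv_mem' := fun ha => hinv _ ha } hi a

/-- The action `f : G(X, r) → Sym_X`. -/
noncomputable def fHom : StructureGroup h →* Equiv.Perm X := liftG h (f h) (f_mul h)

theorem lamGen_rel (z x u : X) : iA h (f h z x) * iA h (f h z u) =
    iA h (f h z u) * iA h (f h z (der h u x)) := by rw [iA_mul, f_der]

/-- The automorphism of `A(X, r)` with `i(x) ↦ i(f_z(x))`. -/
noncomputable def lamGen (z : X) : MulAut (DerivedGroup h) :=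
  MonoidHom.toMulEquiv
    (liftA h (fun x => iA h (f h z x)) (lamGen_rel h z))
    (liftA h (fun x => iA h ((f h z)⁻¹ x)) fun x u => by
      rw [iA_mul]
      congr 2
      apply (f h z).injective
      rw [f_der]
      simp)
    (homA_ext h fun x => by simp [liftA_iA])
    (homA_ext h fun x => by simp [liftA_iA])

theorem lamGen_iA (z x : X) : lamGen h z (iA h x) = iA h (f h z x) :=
  liftA_iA h (fun x => iA h (f h z x)) (lamGen_rel h z) x

theorem mulAutA_ext {k l : MulAut (DerivedGroup h)} (e : ∀ x, k (iA h x) = l (iA h x)) : k = l :=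
  MulEquiv.toMonoidHom_injective (homA_ext h e)

/-- The action `λ : G(X, r) → Aut(A(X, r))`, `λ_{i(z)}(i(x)) = i(f_z(x))`. -/
noncomputable def lamA : StructureGroup h →* MulAut (DerivedGroup h) :=
  liftG h (lamGen h) fun x y => mulAutA_ext h fun z => by
    simp only [MulAut.mul_apply, lamGen_iA]
    rw [(braid_apply h x y z).1]

theorem lamA_iA (b : StructureGroup h) : ∀ x, lamA h b (iA h x) = iA h (fHom h b x) := by
  refine inductionG h ?_ ?_ ?_ ?_ b
  · intro z x
    rw [lamA, fHom, liftG_iG, liftG_iG, lamGen_iA]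
  · simp
  · intro a b ha hb x
    simp [ha, hb]
  · intro a ha x
    rw [map_inv, MulAut.inv_apply, MulEquiv.symm_apply_eq, ha, map_inv, perm_apply_inv_self]

/-- The morphism `G(X, r) → A(X, r) ⋊ G(X, r)` with `x ↦ (i_A(x), i_G(x))`. -/
noncomputable def graphHom : StructureGroup h →* DerivedGroup h ⋊[lamA h] StructureGroup h :=
  liftG h (fun x => ⟨iA h x, iG h x⟩) fun x y => by
    ext
    · simp only [SemidirectProduct.mul_left]
      rw [lamA_iA, lamA_iA, fHom, liftG_iG, liftG_iG, iA_mul, der_f]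
    · exact iG_mul h x y

theorem graphHom_right (b : StructureGroup h) : (graphHom h b).right = b := by
  have : SemidirectProduct.rightHom.comp (graphHom h) = MonoidHom.id _ :=
    homG_ext h fun x => by simp [graphHom, liftG_iG]
  exact DFunLike.congr_fun this b

/-- The bijective 1-cocycle `φ : G(X, r) → A(X, r)`, `φ(i_G(x)) = i_A(x)`. -/
noncomputable def cocycle (b : StructureGroup h) : DerivedGroup h := (graphHom h b).left

theorem cocycle_iG (x : X) : cocycle h (iG h x) = iA h x := by
  simp [cocycle, graphHom, liftG_iG]

theorem cocycle_one : cocycle h 1 = 1 := by simp [cocycle]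

theorem cocycle_mul (a b : StructureGroup h) :
    cocycle h (a * b) = cocycle h a * lamA h a (cocycle h b) := by
  simp [cocycle, graphHom_right]

theorem cocycle_inv (a : StructureGroup h) :
    cocycle h a⁻¹ = (lamA h a⁻¹ (cocycle h a))⁻¹ := by
  rw [eq_inv_iff_mul_eq_one, ← cocycle_mul, inv_mul_cancel, cocycle_one]

/-- `b ↦ b ⋆ i(x) = b · λ_b⁻¹(i(x))` as a permutation of `G(X, r)`. -/
noncomputable def rightStar (x : X) : Equiv.Perm (StructureGroup h) :=
  Equiv.ofBijective (fun b => b * iG h ((fHom h b)⁻¹ x)) <| by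
    have hf : ∀ (b : StructureGroup h) (w : X), fHom h (b * iG h w) = fHom h b * f h w := by
      intro b w; rw [map_mul, fHom, liftG_iG]
    constructor
    · intro b c e
      simp only at e
      have e2 : fHom h b * f h ((fHom h b)⁻¹ x) = fHom h c * f h ((fHom h c)⁻¹ x) := by
        rw [← hf, ← hf, e]
      have e3 : (fHom h b)⁻¹ x = (fHom h c)⁻¹ x := by
        apply (T_bijective h).1
        have := congrArg (fun s : Equiv.Perm X => s⁻¹ x) e2
        simpa only [mul_inv_rev, Equiv.Perm.mul_apply] using this
      rw [e3] at e
      exact mul_right_cancel e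
    · intro c
      obtain ⟨w, hw⟩ := (T_bijective h).2 ((fHom h c)⁻¹ x)
      have key : (fHom h (c * (iG h w)⁻¹))⁻¹ x = w := by
        rw [map_mul, map_inv, mul_inv_rev, inv_inv, Equiv.Perm.mul_apply, ← hw, fHom, liftG_iG,
          perm_apply_inv_self]
      exact ⟨c * (iG h w)⁻¹, by simp only [key, inv_mul_cancel_right]⟩

theorem rightStar_apply (x : X) (b : StructureGroup h) :
    rightStar h x b = b * iG h ((fHom h b)⁻¹ x) := rfl

theorem rightStar_rel (x u : X) :
    rightStar h u * rightStar h x = rightStar h (der h u x) * rightStar h u := by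
  have hf : ∀ (b : StructureGroup h) (w : X), fHom h (b * iG h w) = fHom h b * f h w := by
    intro b w; rw [map_mul, fHom, liftG_iG]
  have hder : ∀ (b : StructureGroup h) (u x : X),
      fHom h b (der h u x) = der h (fHom h b u) (fHom h b x) := by
    intro b
    refine inductionG h ?_ ?_ ?_ ?_ b
    · intro z u x
      rw [fHom, liftG_iG, f_der]
    · simp
    · intro a b ha hb u x
      simp [ha, hb]
    · intro a ha u x
      rw [map_inv, Equiv.Perm.inv_eq_iff_eq, ha]
      simp
  ext b
  obtain ⟨x, rfl⟩ := (fHom h b).surjective x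
  obtain ⟨u, rfl⟩ := (fHom h b).surjective u
  obtain ⟨y, rfl⟩ := (f h x).surjective u
  rw [← hder, der_f]
  simp only [Equiv.Perm.mul_apply, rightStar_apply, hf, mul_inv_rev, perm_inv_apply_self]
  rw [mul_assoc, iG_mul, mul_assoc]

/-- The right translations define an action of `A(X, r)` on the set `G(X, r)`. -/
noncomputable def rightStarHom : DerivedGroup h →* Equiv.Perm (StructureGroup h) :=
  liftA h (fun x => (rightStar h x)⁻¹) fun x u => by
    rw [← mul_inv_rev, ← mul_inv_rev, rightStar_rel]

theorem cocycle_rightStarHom (a : DerivedGroup h) :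
    ∀ b, cocycle h ((rightStarHom h a)⁻¹ b) = cocycle h b * a := by
  refine inductionA h ?_ ?_ ?_ ?_ a
  · intro x b
    rw [rightStarHom, liftA_iA, inv_inv, rightStar_apply, cocycle_mul, cocycle_iG, lamA_iA,
      perm_apply_inv_self]
  · simp
  · intro a c ha hc b
    rw [map_mul, mul_inv_rev, Equiv.Perm.mul_apply, hc, ha, mul_assoc]
  · intro a ha b
    rw [eq_mul_inv_iff_mul_eq, ← ha]
    simp

theorem rightStarHom_cocycle (c : StructureGroup h) :
    ∀ b, (rightStarHom h (lamA h b (cocycle h c)))⁻¹ b = b * c := by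
  refine inductionG h ?_ ?_ ?_ ?_ c
  · intro x b
    rw [cocycle_iG, lamA_iA, rightStarHom, liftA_iA, inv_inv, rightStar_apply,
      perm_inv_apply_self]
  · simp [cocycle_one]
  · intro c d hc hd b
    rw [cocycle_mul, map_mul, map_mul, mul_inv_rev, Equiv.Perm.mul_apply, hc, ← MulAut.mul_apply,
      ← map_mul, hd, mul_assoc]
  · intro c hc b
    have := hc (b * c⁻¹)
    rw [inv_mul_cancel_right, Equiv.Perm.inv_eq_iff_eq] at this
    rw [cocycle_inv, map_inv, map_inv, inv_inv, ← MulAut.mul_apply, ← map_mul, ← this]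

/-- The bijection `φ` between `G(X, r)` and `A(X, r)`. -/
noncomputable def cocycleEquiv : StructureGroup h ≃ DerivedGroup h where
  toFun := cocycle h
  invFun a := (rightStarHom h a)⁻¹ 1
  left_inv b := by simpa using rightStarHom_cocycle h b 1
  right_inv a := by simpa [cocycle_one] using cocycle_rightStarHom h a 1

theorem cocycleEquiv_mul (a b : StructureGroup h) :
    cocycleEquiv h (a * b) = cocycleEquiv h a * lamA h a (cocycleEquiv h b) := cocycle_mul h a b

/-- The star group structure of `G(X, r)`, transported from `A(X, r)` along `φ`. -/
noncomputable instance structureAddGroup : AddGroup (StructureGroup h) :=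
  (((cocycleEquiv h).trans Additive.ofMul).addGroup)

theorem cocycle_add (a b : StructureGroup h) :
    cocycleEquiv h (a + b) = cocycleEquiv h a * cocycleEquiv h b :=
  (cocycleEquiv h).apply_symm_apply _

theorem cocycle_neg (a : StructureGroup h) : cocycleEquiv h (-a) = (cocycleEquiv h a)⁻¹ :=
  (cocycleEquiv h).apply_symm_apply _

/-- The structure group as a skew left brace. -/
noncomputable instance structureBrace : SkewLeftBrace (StructureGroup h) where
  __ := (inferInstance : Group (StructureGroup h))
  __ := structureAddGroup h
  mul_star a b c := (cocycleEquiv h).injective <| by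
    change cocycleEquiv h (a * (b + c)) = cocycleEquiv h (a * b + -a + a * c)
    simp only [cocycleEquiv_mul, cocycle_add, cocycle_neg, map_mul]
    group

/-- The star operation of `G(X, r)` is `b ⋆ c = b · φ⁻¹(λ_b⁻¹(φ(c)))`. -/
theorem structure_star_eq (b c : StructureGroup h) :
    b + c = b * (cocycleEquiv h).symm ((lamA h b)⁻¹ (cocycleEquiv h c)) := by
  apply (cocycleEquiv h).injective
  rw [cocycle_add, cocycleEquiv_mul, Equiv.apply_symm_apply, MulAut.apply_inv_self]

/-- The permutation group `𝒢(X, r) = ⟨(f_x, g̃_x⁻¹) : x ∈ X⟩ ≤ Sym_X × Sym_X`. -/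
def permutationGroup : Subgroup (Equiv.Perm X × Equiv.Perm X) :=
  Subgroup.closure (Set.range fun x => (f h x, (gt h x)⁻¹))

/-- The morphism `G(X, r) → Sym_X × Sym_X`, `a ↦ (f_a, g̃_a⁻¹)`. -/
noncomputable def permHom : StructureGroup h →* Equiv.Perm X × Equiv.Perm X :=
  liftG h (fun x => (f h x, (gt h x)⁻¹)) fun x y => by
    ext1
    · exact f_mul h x y
    · simp only [Prod.snd_mul, ← mul_inv_rev, gt_mul h x y]

theorem range_permHom : (permHom h).range = permutationGroup h := by
  rw [MonoidHom.range_eq_map, ← PresentedGroup.closure_range_of, MonoidHom.map_closure,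
    ← Set.range_comp, permutationGroup]
  congr 2

/-- The morphism `A(X, r) → Sym_X` with `i(u) ↦ g̃_u⁻¹ f_u⁻¹`. -/
noncomputable def kap : DerivedGroup h →* Equiv.Perm X :=
  liftA h (fun u => (der h u)⁻¹) fun x u => by
    rw [← mul_inv_rev, ← mul_inv_rev, der_mul_der]

theorem kap_lamA (b : StructureGroup h) (a : DerivedGroup h) :
    kap h (lamA h b a) = fHom h b * kap h a * (fHom h b)⁻¹ := by
  revert a
  refine inductionG h ?_ ?_ ?_ ?_ b
  · intro z a
    have : (kap h).comp (lamA h (iG h z)).toMonoidHom =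
        (MulAut.conj (f h z)).toMonoidHom.comp (kap h) := homA_ext h fun u => by
      simp only [MonoidHom.comp_apply, MulEquiv.toMonoidHom_eq_coe, MonoidHom.coe_coe,
        MulAut.conj_apply]
      rw [lamA_iA, kap, liftA_iA, liftA_iA, fHom, liftG_iG, eq_mul_inv_iff_mul_eq,
        inv_mul_eq_iff_eq_mul, ← mul_assoc, ← f_mul_der, mul_inv_cancel_right]
    have := DFunLike.congr_fun this a
    rw [fHom, liftG_iG]
    exact this
  · simp
  · intro b c hb hc a
    rw [map_mul, MulAut.mul_apply, hb, hc, map_mul]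
    group
  · intro b hb a
    have := hb (lamA h b⁻¹ a)
    rw [← MulAut.mul_apply, ← map_mul, mul_inv_cancel, map_one, MulAut.one_apply] at this
    rw [this, map_inv (fHom h)]
    simp [mul_assoc]

theorem permHom_fst (b : StructureGroup h) : (permHom h b).1 = fHom h b := by
  have : (MonoidHom.fst _ _).comp (permHom h) = fHom h :=
    homG_ext h fun x => by simp [permHom, fHom, liftG_iG]
  exact DFunLike.congr_fun this b

theorem permHom_snd (b : StructureGroup h) :
    (permHom h b).2 = kap h (cocycleEquiv h b) * fHom h b := by
  refine inductionG h ?_ ?_ ?_ ?_ b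
  · intro x
    change _ = kap h (cocycle h _) * _
    rw [cocycle_iG, permHom, liftG_iG, kap, liftA_iA, fHom, liftG_iG, der]
    group
  · change _ = kap h (cocycle h _) * _
    simp [cocycle_one]
  · intro a b ha hb
    rw [map_mul, Prod.snd_mul, ha, hb, cocycleEquiv_mul, map_mul, kap_lamA, map_mul]
    group
  · intro a ha
    change _ = kap h (cocycle h _) * _
    rw [map_inv, Prod.snd_inv, ha, cocycle_inv, map_inv, kap_lamA, map_inv]
    change _ = (_ * kap h (cocycleEquiv h a) * _)⁻¹ * _
    group

theorem conj_iA (a : DerivedGroup h) : ∀ x, a * iA h x * a⁻¹ = iA h (kap h a x) := by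
  refine inductionA h ?_ ?_ ?_ ?_ a
  · intro u x
    obtain ⟨x, rfl⟩ := (der h u).surjective x
    rw [← iA_mul, mul_inv_cancel_right, kap, liftA_iA, perm_inv_apply_self]
  · simp
  · intro a b ha hb x
    rw [map_mul, Equiv.Perm.mul_apply, ← ha, ← hb]
    group
  · intro a ha x
    rw [map_inv, ← mul_left_cancel_iff (a := a), ← mul_right_cancel_iff (a := a⁻¹), ha,
      perm_apply_inv_self]
    group

/-- The kernel of `G(X, r) → 𝒢(X, r)` acts trivially through `λ`. -/
theorem ker_mul (k b : StructureGroup h) (hk : permHom h k = 1) : k * b = k + b := by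
  apply (cocycleEquiv h).injective
  rw [cocycleEquiv_mul, cocycle_add]
  congr 1
  have : lamA h k = 1 := mulAutA_ext h fun x => by
    rw [lamA_iA, ← permHom_fst, hk]; simp
  rw [this, MulAut.one_apply]

/-- The kernel of `G(X, r) → 𝒢(X, r)` is central in the star group. -/
theorem ker_comm (k b : StructureGroup h) (hk : permHom h k = 1) : k + b = b + k := by
  apply (cocycleEquiv h).injective
  rw [cocycle_add, cocycle_add]
  have hkap : kap h (cocycleEquiv h k) = 1 := by
    have := permHom_snd h k
    rw [← permHom_fst, hk] at this
    simpa using this.symm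
  have : MulAut.conj (cocycleEquiv h k) = 1 := mulAutA_ext h fun x => by
    rw [MulAut.conj_apply, conj_iA, hkap]; simp
  have := DFunLike.congr_fun this (cocycleEquiv h b)
  rw [MulAut.conj_apply, MulAut.one_apply] at this
  exact mul_inv_eq_iff_eq_mul.1 this

theorem permHom_ker_add (k b : StructureGroup h) (hk : permHom h k = 1) :
    permHom h (k + b) = permHom h b := by
  rw [← ker_mul h k b hk, map_mul, hk, one_mul]

theorem permHom_add_congr {a a' b b' : StructureGroup h} (ha : permHom h a = permHom h a')
    (hb : permHom h b = permHom h b') : permHom h (a + b) = permHom h (a' + b') := by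
  have key : ∀ {c c' : StructureGroup h}, permHom h c = permHom h c' →
      ∃ k, permHom h k = 1 ∧ c = k + c' := fun {c c'} e =>
    ⟨c * c'⁻¹, by simp [e], by
      rw [← ker_mul h _ _ (by simp [e]), inv_mul_cancel_right]⟩
  obtain ⟨k, hk, rfl⟩ := key ha
  obtain ⟨l, hl, rfl⟩ := key hb
  rw [add_assoc, permHom_ker_add h _ _ hk, ← add_assoc, ← ker_comm h l a' hl, add_assoc,
    permHom_ker_add h _ _ hl]

/-- The surjective morphism `G(X, r) → 𝒢(X, r)`. -/
noncomputable def toPerm : StructureGroup h →* permutationGroup h :=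
  (permHom h).codRestrict _ fun b => by rw [← range_permHom]; exact ⟨b, rfl⟩

theorem toPerm_surjective : Function.Surjective (toPerm h) := by
  rintro ⟨p, hp⟩
  rw [← range_permHom] at hp
  obtain ⟨b, hb⟩ := hp
  exact ⟨b, Subtype.ext hb⟩

theorem toPerm_add_congr {a a' b b' : StructureGroup h} (ha : toPerm h a = toPerm h a')
    (hb : toPerm h b = toPerm h b') : toPerm h (a + b) = toPerm h (a' + b') :=
  Subtype.ext (permHom_add_congr h (congrArg Subtype.val ha) (congrArg Subtype.val hb))

/-- The star operation of `𝒢(X, r)`: the one of `G(X, r)` computed on preimages. -/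
noncomputable instance permAdd : Add (permutationGroup h) where
  add p q := toPerm h
    (Function.surjInv (toPerm_surjective h) p + Function.surjInv (toPerm_surjective h) q)

theorem toPerm_add (a b : StructureGroup h) : toPerm h (a + b) = toPerm h a + toPerm h b :=
  toPerm_add_congr h (Function.surjInv_eq _ _).symm (Function.surjInv_eq _ _).symm

noncomputable instance permZero : Zero (permutationGroup h) where
  zero := toPerm h 0

noncomputable instance permNeg : Neg (permutationGroup h) where
  neg p := toPerm h (-Function.surjInv (toPerm_surjective h) p)

theorem toPerm_neg (a : StructureGroup h) : toPerm h (-a) = -toPerm h a := by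
  set b := Function.surjInv (toPerm_surjective h) (toPerm h a) with hb
  have e : toPerm h b = toPerm h a := Function.surjInv_eq _ _
  change toPerm h (-a) = toPerm h (-b)
  have e2 : toPerm h (-a + b + -b) = toPerm h (-a + a + -b) :=
    toPerm_add_congr h (toPerm_add_congr h rfl e) rfl
  simpa using e2

noncomputable instance permAddGroup : AddGroup (permutationGroup h) :=
  AddGroup.ofLeftAxioms
    (fun p q s => by
      obtain ⟨a, rfl⟩ := toPerm_surjective h p
      obtain ⟨b, rfl⟩ := toPerm_surjective h q
      obtain ⟨c, rfl⟩ := toPerm_surjective h s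
      rw [← toPerm_add, ← toPerm_add, ← toPerm_add, ← toPerm_add, add_assoc])
    (fun p => by
      obtain ⟨a, rfl⟩ := toPerm_surjective h p
      change toPerm h 0 + _ = _
      rw [← toPerm_add, zero_add])
    (fun p => by
      obtain ⟨a, rfl⟩ := toPerm_surjective h p
      change _ = toPerm h 0
      rw [← toPerm_neg, ← toPerm_add, neg_add_cancel])

/-- The permutation group as a skew left brace: the unique structure for which
`G(X, r) → 𝒢(X, r)` is a morphism of skew left braces. -/
noncomputable instance permBrace : SkewLeftBrace (permutationGroup h) where
  __ := (inferInstance : Group (permutationGroup h))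
  __ := permAddGroup h
  mul_star p q s := by
    obtain ⟨a, rfl⟩ := toPerm_surjective h p
    obtain ⟨b, rfl⟩ := toPerm_surjective h q
    obtain ⟨c, rfl⟩ := toPerm_surjective h s
    have := congrArg (toPerm h) (SkewLeftBrace.mul_star a b c)
    rw [map_mul, toPerm_add, toPerm_add, toPerm_add, toPerm_neg, map_mul, map_mul] at this
    exact this

end

/-! ### The construction of solutions from a skew left brace -/

open SkewLeftBrace

/-- Two skew left braces are isomorphic: there is a bijection that preserves both operations.
(`≃+*` only refers to the operations `*` and `+`, no ring structure is involved.) -/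
def BraceIsomorphic (A : Type v) (B : Type u) [SkewLeftBrace A] [SkewLeftBrace B] : Prop :=
  Nonempty (A ≃+* B)

/-- The ingredients of the construction, for a choice `a i` of an element in each orbit `i`: a
non-empty set `I` of orbits whose union generates `(B, ⋆)`, non-empty index sets `J i`, and
subgroups `K i j` of the stabilizer of `a i` such that the only `b` with `(1, b)` and `(b, b)` in
the cores of all the `K i j` is `1`. -/
structure ConstructionData {B : Type u} [SkewLeftBrace B] (a : Orbits B → B) where
  I : Set (Orbits B)
  I_nonempty : I.Nonempty
  generates : AddSubgroup.closure (⋃ i ∈ I, i.orbit) = ⊤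
  J : I → Type v
  J_nonempty : ∀ i, Nonempty (J i)
  K : ∀ i : I, J i → Subgroup (SemiProd B)
  K_le : ∀ i j, K i j ≤ MulAction.stabilizer (SemiProd B) (a i)
  core_trivial : {b : B | pair 1 b ∈ ⨅ i, ⨅ j, (K i j).normalCore ∧
    pair b b ∈ ⨅ i, ⨅ j, (K i j).normalCore} = {1}

namespace ConstructionData

variable {B : Type u} [SkewLeftBrace B] {a : Orbits B → B} (D : ConstructionData.{u, v} a)

/-- The disjoint union of the sets of left cosets `G / K_{i,j}`, where `G = (B, ⋆) ⋊ (B, ·)`. It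
is a `G`-set by left multiplication. -/
abbrev X : Type (max u v) := Σ i : D.I, Σ j : D.J i, SemiProd B ⧸ D.K i j

/-- The coset `x K_{i,j}`. -/
def coset (i : D.I) (j : D.J i) (x : SemiProd B) : D.X := ⟨i, j, QuotientGroup.mk x⟩

/-- The map `X → B`, `(b, c) K_{i,j} ↦ Θ_{(b,c)}(a_i)`. -/
def eta (x : D.X) : B :=
  Quotient.liftOn' x.2.2 (fun y => y • a x.1) fun y z hyz => by
    have := D.K_le _ _ (QuotientGroup.leftRel_apply.1 hyz)
    rw [MulAction.mem_stabilizer_iff, mul_smul, inv_smul_eq_iff] at this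
    exact this.symm

/-- The map `r (x, y) = (f_x(y), g_y(x))` with `f_x(y) = (1, η(x)) y` and
`g_y(x) = (w, w)⁻¹ x`, where `w = Θ_{(1, η(x))}(η(y))`. -/
def r (p : D.X × D.X) : D.X × D.X :=
  (pair 1 (D.eta p.1) • p.2,
    (pair (pair 1 (D.eta p.1) • D.eta p.2) (pair 1 (D.eta p.1) • D.eta p.2))⁻¹ • p.1)

end ConstructionData

end YangBaxter

/-! Write `G` for `(B, ⋆) ⋊ (B, ·)`. The data behind a solution is a `G`-set `X` with an equivariant
map `η : X → B`. The group `(B, ·)` embeds in `G` by `b ↦ (1, b)` and by `b ↦ (b, b)`; let `f_x` act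
as `(1, η x)` and `g̃_u` as the inverse of `(η u, η u)`. For `X = B`, `η = id` this is the usual
solution `(p, q) ↦ (λ_p(q), ρ_q(p))` of a skew left brace, with `λ_p(q) · ρ_q(p) = p · q`
(`inrHom_smul_mul`). On a general `X` the braid relation follows from identities in `B` and the
exchange rule `inrHom_mul_diagHom` in `G`.

The map `η` extends to a brace morphism from the structure group to `B` (`liftG_add`), onto as soon
as `η(X)` generates `(B, ⋆)`. The map to the permutation group factors through it by letting `b` act
as `(1, b)` and as `(b, b)`. The core condition makes this last map injective, so `B` and the
permutation group are the same quotient of the structure group.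

Conversely, if the permutation group of `(Z, t)` is `B`, first components give an action of `(B, ·)`
on `Z`, and second components times inverses of first ones give an action of `(B, ⋆)`. Together they
form an action of `G` for which `z ↦ (f_z, g̃_z⁻¹)` is equivariant (`generator_braceActionHom`) and
from which `t` is recovered (`solution_eq`). Splitting `Z` into orbits, with base points over the
chosen `a i`, gives the coset spaces. -/

namespace SkewLeftBrace

/-! ### Two embeddings of the multiplicative group into the semidirect product -/

variable {B : Type u} [SkewLeftBrace B]

theorem pair_one_smul (b c : B) : pair 1 b • c = -b + b * c := by
  simp [pair_smul, ← zero_eq_one]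

theorem pair_self_smul (b c : B) : pair b b • c = b * c + -b := by
  simp [pair_smul]

theorem pair_one_right_smul (b c : B) : pair b 1 • c = b + c + -b := by
  rw [pair_smul, one_mul, ← zero_eq_one, neg_zero, zero_add]

theorem pair_one_mul (b c : B) : pair 1 (b * c) = pair 1 b * pair 1 c := by
  rw [pair_mul_pair, ← zero_eq_one, mul_zero_eq, neg_add_cancel, add_zero]

theorem pair_self_mul (b c : B) : pair (b * c) (b * c) = pair b b * pair c c := by
  rw [pair_mul_pair, add_neg_cancel_left]

/-- The embedding `b ↦ (1, b)` of `(B, ·)` into `(B, ⋆) ⋊ (B, ·)`. -/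
def inrHom (B : Type u) [SkewLeftBrace B] : B →* SemiProd B :=
  MonoidHom.mk' (fun b => pair 1 b) pair_one_mul

/-- The embedding `b ↦ (b, b)` of `(B, ·)` into `(B, ⋆) ⋊ (B, ·)`. -/
def diagHom (B : Type u) [SkewLeftBrace B] : B →* SemiProd B :=
  MonoidHom.mk' (fun b => pair b b) pair_self_mul

theorem inrHom_apply (b : B) : inrHom B b = pair 1 b := rfl

theorem diagHom_apply (b : B) : diagHom B b = pair b b := rfl

theorem inrHom_smul (b c : B) : inrHom B b • c = -b + b * c := pair_one_smul b c

theorem diagHom_smul (b c : B) : diagHom B b • c = b * c + -b := pair_self_smul b c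

/-- The product of `(1, p) • q` and `((1, p) • q, (1, p) • q)⁻¹ • p` is `p · q`. -/
theorem inrHom_smul_mul (p q : B) :
    (inrHom B p • q) * ((diagHom B (inrHom B p • q))⁻¹ • p) = p * q := by
  generalize hw : inrHom B p • q = w
  rw [← map_inv, diagHom_smul, mul_star, mul_neg_eq, mul_inv_cancel_left, mul_inv_cancel,
    ← zero_eq_one, neg_zero, add_zero, add_assoc,
    neg_add_cancel_left, ← hw, inrHom_smul,
    add_neg_cancel_left]

theorem mul_eq_add (p q : B) : p * q = p + inrHom B p • q := by
  rw [inrHom_smul, add_neg_cancel_left]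

theorem inrHom_smul_add (p q s : B) :
    inrHom B p • (q + s) = inrHom B p • q + inrHom B p • s := by
  simp [inrHom_smul, mul_star, add_assoc]

theorem diagHom_mul_inrHom (b c : B) : diagHom B b * inrHom B c = pair b (b * c) := by
  rw [diagHom_apply, inrHom_apply, pair_mul_pair, ← zero_eq_one, mul_zero_eq, neg_add_cancel,
    add_zero]

/-- Both sides are the pair `(λ_p(t), p · t)`. This exchange rule carries the middle component of
the braid relation. -/
theorem inrHom_mul_diagHom (p t : B) :
    inrHom B p * diagHom B t = diagHom B (inrHom B p • t) *
      inrHom B ((diagHom B (inrHom B p • t))⁻¹ • p) := by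
  rw [diagHom_mul_inrHom, inrHom_smul_mul, inrHom_apply, diagHom_apply, pair_mul_pair,
    ← inrHom_smul, ← zero_eq_one, zero_add, inrHom_apply, zero_eq_one]

theorem inv_mul_inrHom_smul (p q : B) : p⁻¹ * inrHom B p • q = p⁻¹ + q := by
  rw [mul_eq_add, map_inv, inv_smul_smul]

/-- Let `w = λ_p(q)` and `m = ρ_q(p)`, so `w · m = p · q`. Then `p⁻¹ · w` equals both `q · m⁻¹` and
`p⁻¹ ⋆ q`, which determines `p` from `m` and `q`. With the next lemma this inverts `ρ_q`, hence
`g_y` at the level of `B`. -/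
theorem recover_left (p q : B) :
    (q * ((diagHom B (inrHom B p • q))⁻¹ • p)⁻¹ + -q)⁻¹ = p := by
  rw [inv_eq_iff_eq_inv, ← sub_eq_add_neg, sub_eq_iff_eq_add, ← inv_mul_inrHom_smul,
    mul_inv_eq_iff_eq_mul, mul_assoc, inrHom_smul_mul, inv_mul_cancel_left]

theorem diagHom_inv_smul_recover (m q : B) :
    (diagHom B (inrHom B (q * m⁻¹ + -q)⁻¹ • q))⁻¹ • (q * m⁻¹ + -q)⁻¹ = m := by
  generalize hp : (q * m⁻¹ + -q)⁻¹ = p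
  have h : p⁻¹ * inrHom B p • q = q * m⁻¹ := by
    rw [inv_mul_inrHom_smul, ← hp, inv_inv, neg_add_cancel_right]
  have h2 := inrHom_smul_mul p q
  rw [inv_mul_eq_iff_eq_mul] at h
  rw [← mul_right_inj (inrHom B p • q), h2, h, mul_assoc, inv_mul_cancel_right]

/-- `λ_p(q) · λ_{ρ_q(p)}(s) = λ_p(q · s)`, where `λ_p(q) · ρ_q(p) = p · q`. -/
theorem inrHom_smul_mul_inrHom_smul (p q s : B) :
    (inrHom B p • q) * (inrHom B ((diagHom B (inrHom B p • q))⁻¹ • p) • s) =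
      inrHom B p • (q * s) := by
  rw [mul_eq_add (inrHom B p • q), ← mul_smul, ← map_mul, inrHom_smul_mul, mul_eq_add q s,
    inrHom_smul_add, map_mul, mul_smul]

end SkewLeftBrace

/-! ### Solutions from equivariant maps to a skew left brace -/

namespace YangBaxter

open SkewLeftBrace

section ActionSolution

variable {B : Type u} [SkewLeftBrace B] {X : Type v} [MulAction (SemiProd B) X] (η : X → B)

/-- The map `r (x, y) = (f_x(y), g_y(x))` with `f_x(y) = (1, η(x)) y` and
`g_y(x) = (w, w)⁻¹ x`, where `w = Θ_{(1, η(x))}(η(y))`. -/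
def actionSolution (p : X × X) : X × X :=
  (inrHom B (η p.1) • p.2, (diagHom B (inrHom B (η p.1) • η p.2))⁻¹ • p.1)

variable {η}

/-- By equivariance the first output `u` has `η u = w`, the element used to move `x`; so `x` is
recovered first, and then `y`. -/
theorem actionSolution_bijective (hη : ∀ (g : SemiProd B) x, η (g • x) = g • η x)
    :  Function.Bijective (actionSolution η) := by
  refine Function.bijective_iff_has_inverse.2 ⟨fun p => (diagHom B (η p.1) • p.2,
    (inrHom B (η (diagHom B (η p.1) • p.2)))⁻¹ • p.1), ?_, ?_⟩
  · rintro ⟨x, y⟩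
    simp [actionSolution, hη]
  · rintro ⟨x, y⟩
    simp [actionSolution, hη]

theorem actionSolution_braid (hη : ∀ (g : SemiProd B) x, η (g • x) = g • η x)
    :  onLeft (actionSolution η) ∘ onRight (actionSolution η) ∘
    onLeft (actionSolution η) = onRight (actionSolution η) ∘ onLeft (actionSolution η) ∘
      onRight (actionSolution η) := by
  funext ⟨x, y, z⟩
  simp only [Function.comp_apply, onLeft, onRight, actionSolution, hη, Prod.mk.injEq]
  refine ⟨?_, ?_, ?_⟩
  · rw [← mul_smul, ← map_mul, inrHom_smul_mul, map_mul, mul_smul]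
  · rw [← mul_smul (inrHom B (inrHom B (η x) • η y)), ← map_mul, inrHom_smul_mul, map_mul,
      mul_smul, inv_smul_eq_iff, ← mul_smul, ← mul_smul,
      ← inrHom_mul_diagHom, mul_inv_cancel_right]
  -- Two successive diagonal actions combine into one, and on each side the product of their
  -- parameters is `λ_p(q · s)`, where `p`, `q`, `s` are the images of `x`, `y`, `z`.
  · rw [← mul_smul, ← mul_smul, ← mul_inv_rev, ← mul_inv_rev, ← map_mul, ← map_mul,
      inrHom_smul_mul_inrHom_smul, inrHom_smul_mul_inrHom_smul, inrHom_smul_mul]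

theorem actionSolution_g_bijective (hη : ∀ (g : SemiProd B) x, η (g • x) = g • η x)
    (y : X) :
    Function.Bijective fun x => (actionSolution η (x, y)).2 := by
  -- The value of `η` at the preimage is given by `recover_left`; it determines `w`, and the action
  -- of `(w, w)` then undoes `g_y`.
  refine Function.bijective_iff_has_inverse.2 ⟨fun x =>
    diagHom B (inrHom B (η y * (η x)⁻¹ + -η y)⁻¹ • η y) • x, fun x => ?_, fun x => ?_⟩
  · simp only [actionSolution, hη, recover_left, smul_inv_smul]
  · have := diagHom_inv_smul_recover (η x) (η y)
    rw [inv_smul_eq_iff] at this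
    simp only [actionSolution, hη, ← this, inv_smul_smul]

theorem actionSolution_isNonDegenerate (hη : ∀ (g : SemiProd B) x, η (g • x) = g • η x)
    [Nonempty X] : IsNonDegenerate (actionSolution η) where
  nonempty := inferInstance
  bijective := actionSolution_bijective hη
  braid := actionSolution_braid hη
  f_bijective x := MulAction.bijective (inrHom B (η x))
  g_bijective := actionSolution_g_bijective hη

end ActionSolution

/-! ### Brace morphisms out of the structure group -/

section UniversalProperty

variable {B : Type u} [SkewLeftBrace B] {X : Type v} {r : X × X → X × X} (h : IsNonDegenerate r)
  {k : X → B}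

/-- Both sides equal `k x * k y` when `u = f_x(y)`, since `p · q = p ⋆ λ_p(q)`. These are the
relations of the derived group. -/
theorem add_eq_add_der (hf : ∀ x y, k (f h x y) = inrHom B (k x) • k y)
    (hm : ∀ x y, k x * k y = k (f h x y) * k (g h y x)) (x u : X) :
    k x + k u = k u + k (der h u x) := by
  obtain ⟨y, rfl⟩ := (f h x).surjective u
  rw [der_f, hf (f h x y), ← mul_eq_add, ← hm, mul_eq_add, hf]

/-- The morphism `A(X, r) → (B, ⋆)` induced by a map `X → B`. -/
def liftStar (hf : ∀ x y, k (f h x y) = inrHom B (k x) • k y)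
    (hm : ∀ x y, k x * k y = k (f h x y) * k (g h y x)) : DerivedGroup h →* Multiplicative B :=
  liftA h (fun x => Multiplicative.ofAdd (k x)) fun x u =>
    congrArg Multiplicative.ofAdd (add_eq_add_der h hf hm x u)

theorem liftStar_lamA (hf : ∀ x y, k (f h x y) = inrHom B (k x) • k y)
    (hm : ∀ x y, k x * k y = k (f h x y) * k (g h y x)) (b : StructureGroup h) :
    ∀ a, liftStar h hf hm (lamA h b a) = lamHom B (liftG h k hm b) (liftStar h hf hm a) := by
  refine inductionG h ?_ ?_ ?_ ?_ b
  · intro x a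
    have : (liftStar h hf hm).comp (lamA h (iG h x)).toMonoidHom =
        (lamHom B (liftG h k hm (iG h x))).toMonoidHom.comp (liftStar h hf hm) :=
      homA_ext h fun y => by
        simp only [MonoidHom.comp_apply, MulEquiv.toMonoidHom_eq_coe, MonoidHom.coe_coe]
        rw [lamA_iA, fHom, liftG_iG, liftG_iG, liftStar, liftA_iA, liftA_iA, hf, inrHom_smul]
        rfl
    exact DFunLike.congr_fun this a
  · simp
  · intro b c hb hc a
    simp [hb, hc]
  · intro b hb a
    have := hb (lamA h b⁻¹ a)
    rw [← MulAut.mul_apply, ← map_mul, mul_inv_cancel, map_one, MulAut.one_apply] at this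
    rw [this, ← MulAut.mul_apply, ← map_mul, ← map_mul, inv_mul_cancel, map_one, map_one,
      MulAut.one_apply]

/-- Both sides are 1-cocycles on the structure group for the same action on `(B, ⋆)`, and they agree
on generators. This links the multiplicative and the star extension of `k`. -/
theorem liftStar_cocycle (hf : ∀ x y, k (f h x y) = inrHom B (k x) • k y)
    (hm : ∀ x y, k x * k y = k (f h x y) * k (g h y x)) (b : StructureGroup h) :
    liftStar h hf hm (cocycleEquiv h b) = Multiplicative.ofAdd (liftG h k hm b) := by
  refine inductionG h ?_ ?_ ?_ ?_ b
  · intro x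
    change liftStar h hf hm (cocycle h _) = _
    rw [cocycle_iG, liftG_iG, liftStar, liftA_iA]
  · change liftStar h hf hm (cocycle h 1) = _
    rw [cocycle_one, map_one, map_one, ← zero_eq_one, ofAdd_zero]
  · intro a b ha hb
    rw [cocycleEquiv_mul, map_mul, liftStar_lamA, ha, hb, map_mul, mul_eq_add, inrHom_smul]
    rfl
  · intro a ha
    change liftStar h hf hm (cocycle h _) = _
    rw [cocycle_inv, map_inv, liftStar_lamA, inv_eq_iff_mul_eq_one]
    change lamHom B _ (liftStar h hf hm (cocycleEquiv h a)) * _ = 1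
    rw [ha]
    apply Multiplicative.toAdd.injective
    rw [map_inv]
    change -(liftG h k hm a)⁻¹ + (liftG h k hm a)⁻¹ * liftG h k hm a + (liftG h k hm a)⁻¹ = 0
    rw [inv_mul_cancel, ← zero_eq_one, add_zero, neg_add_cancel]

theorem liftG_add (hf : ∀ x y, k (f h x y) = inrHom B (k x) • k y)
    (hm : ∀ x y, k x * k y = k (f h x y) * k (g h y x)) (a b : StructureGroup h) :
    liftG h k hm (a + b) = liftG h k hm a + liftG h k hm b := by
  apply Multiplicative.ofAdd.injective
  rw [← liftStar_cocycle h hf hm, cocycle_add, map_mul, liftStar_cocycle, liftStar_cocycle,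
    ofAdd_add]

/-- As `liftG` also respects the star operations, its image is a subgroup of `(B, ⋆)`, so generating
the star group suffices. -/
theorem liftG_surjective (hf : ∀ x y, k (f h x y) = inrHom B (k x) • k y)
    (hm : ∀ x y, k x * k y = k (f h x y) * k (g h y x))
    (hk : AddSubgroup.closure (Set.range k) = ⊤) : Function.Surjective (liftG h k hm) := by
  have key : AddSubgroup.closure (Set.range k) ≤
      (AddMonoidHom.mk' (liftG h k hm) (liftG_add h hf hm)).range := by
    rw [AddSubgroup.closure_le]
    rintro _ ⟨x, rfl⟩
    exact ⟨iG h x, liftG_iG h k hm x⟩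
  intro b
  exact key (hk ▸ AddSubgroup.mem_top b)

end UniversalProperty

/-! ### The permutation brace of a solution given by an action -/

section ActionSolution

variable {B : Type u} [SkewLeftBrace B] {X : Type v} [MulAction (SemiProd B) X] {η : X → B}

theorem f_actionSolution (h : IsNonDegenerate (actionSolution η)) (x y : X) :
    f h x y = inrHom B (η x) • y := rfl

theorem gt_actionSolution (h : IsNonDegenerate (actionSolution η))
    (hη : ∀ (g : SemiProd B) x, η (g • x) = g • η x) (u x : X) :
    gt h u x = (diagHom B (η u))⁻¹ • x := by
  obtain ⟨y, rfl⟩ := (f h x).surjective u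
  rw [gt_f, f_actionSolution, hη]
  rfl

/-- The morphism `(B, ·) → Sym_X × Sym_X` through which `b` acts as `(1, b)` in the first component
and as `(b, b)` in the second one. -/
def twoActions (B : Type u) [SkewLeftBrace B] (X : Type v) [MulAction (SemiProd B) X] :
    B →* Equiv.Perm X × Equiv.Perm X :=
  ((MulAction.toPermHom (SemiProd B) X).comp (inrHom B)).prod
    ((MulAction.toPermHom (SemiProd B) X).comp (diagHom B))

theorem twoActions_apply (b : B) :
    twoActions B X b = (MulAction.toPerm (inrHom B b), MulAction.toPerm (diagHom B b)) := rfl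

/-- The structure group maps onto both braces. The two maps have the same fibres because `permHom`
is `liftG` followed by the injective `twoActions`. -/
theorem permutationGroup_actionSolution (h : IsNonDegenerate (actionSolution η))
    (hη : ∀ (g : SemiProd B) x, η (g • x) = g • η x)
    (hgen : AddSubgroup.closure (Set.range η) = ⊤)
    (hinj : Function.Injective (twoActions B X)) :
    BraceIsomorphic (permutationGroup h) B := by
  have hf : ∀ x y, η (f h x y) = inrHom B (η x) • η y := fun x y => hη _ _
  have hm : ∀ x y, η x * η y = η (f h x y) * η (g h y x) := fun x y => by
    change _ = η (inrHom B (η x) • y) * η ((diagHom B (inrHom B (η x) • η y))⁻¹ • x)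
    rw [hη, hη, inrHom_smul_mul]
  have hperm : ∀ b, permHom h b = twoActions B X (liftG h η hm b) := fun b => by
    have : permHom h = (twoActions B X).comp (liftG h η hm) := homG_ext h fun x => by
      rw [permHom, liftG_iG, MonoidHom.comp_apply, liftG_iG, twoActions_apply]
      refine Prod.ext (Equiv.ext fun _ => rfl) ?_
      rw [inv_eq_iff_eq_inv]
      ext z
      rw [gt_actionSolution h hη]
      rfl
    exact DFunLike.congr_fun this b
  have hsurj := liftG_surjective h hf hm hgen
  have hiff : ∀ a b, toPerm h a = toPerm h b ↔ liftG h η hm a = liftG h η hm b := fun a b => by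
    rw [Subtype.ext_iff, ← hinj.eq_iff, ← hperm, ← hperm]
    rfl
  -- By `hiff`, the image in `B` does not depend on the chosen preimage.
  let s := Function.surjInv (toPerm_surjective h)
  have hs : ∀ p, toPerm h (s p) = p := Function.surjInv_eq _
  refine ⟨{ toEquiv := Equiv.ofBijective (fun p => liftG h η hm (s p)) ⟨?_, ?_⟩,
            map_mul' := ?_, map_add' := ?_ }⟩
  · intro p q e
    rw [← hs p, ← hs q]
    exact (hiff _ _).2 e
  · intro b
    obtain ⟨a, rfl⟩ := hsurj b
    exact ⟨toPerm h a, (hiff _ _).1 (hs _)⟩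
  · intro p q
    change liftG h η hm (s (p * q)) = liftG h η hm (s p) * liftG h η hm (s q)
    rw [← map_mul, ← hiff, hs, map_mul, hs, hs]
  · intro p q
    change liftG h η hm (s (p + q)) = liftG h η hm (s p) + liftG h η hm (s q)
    rw [← liftG_add h hf, ← hiff, hs, toPerm_add, hs, hs]

end ActionSolution

/-! ### The solution on a disjoint union of coset spaces -/

namespace ConstructionData

variable {B : Type u} [SkewLeftBrace B] {a : Orbits B → B} (D : ConstructionData.{u, v} a)

theorem r_eq_actionSolution : D.r = actionSolution D.eta := rfl

theorem eta_coset (i : D.I) (j : D.J i) (x : SemiProd B) : D.eta (D.coset i j x) = x • a i := rfl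

theorem exists_coset (x : D.X) : ∃ i j y, x = D.coset i j y := by
  obtain ⟨i, j, y⟩ := x
  obtain ⟨y, rfl⟩ := QuotientGroup.mk_surjective y
  exact ⟨i, j, y, rfl⟩

theorem smul_coset (x : SemiProd B) (i : D.I) (j : D.J i) (y : SemiProd B) :
    x • D.coset i j y = D.coset i j (x * y) := rfl

theorem coset_eq {i : D.I} {j : D.J i} {x y : SemiProd B} :
    D.coset i j x = D.coset i j y ↔ x⁻¹ * y ∈ D.K i j := by
  rw [← QuotientGroup.eq]
  simp [coset]

theorem eta_smul (x : SemiProd B) (y : D.X) : D.eta (x • y) = x • D.eta y := by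
  obtain ⟨i, j, y, rfl⟩ := D.exists_coset y
  rw [smul_coset, eta_coset, eta_coset, mul_smul]

theorem nonempty : Nonempty D.X := by
  obtain ⟨i, hi⟩ := D.I_nonempty
  obtain ⟨j⟩ := D.J_nonempty ⟨i, hi⟩
  exact ⟨D.coset ⟨i, hi⟩ j 1⟩

theorem closure_range_eta (ha : ∀ i, a i ∈ i.orbit) :
    AddSubgroup.closure (Set.range D.eta) = ⊤ := by
  rw [eq_top_iff, ← D.generates]
  refine AddSubgroup.closure_mono (Set.iUnion₂_subset fun i hi b hb => ?_)
  obtain ⟨j⟩ := D.J_nonempty ⟨i, hi⟩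
  have h1 := ha i
  rw [MulAction.orbitRel.Quotient.mem_orbit] at h1 hb
  obtain ⟨x, hx⟩ : b ∈ MulAction.orbit (SemiProd B) (a i) :=
    MulAction.orbitRel_apply.1 (Quotient.eq''.1 (hb.trans h1.symm))
  exact ⟨D.coset ⟨i, hi⟩ j x, hx⟩

theorem mem_iInf_normalCore {x : SemiProd B} (hx : ∀ y : D.X, x • y = y) :
    x ∈ ⨅ i, ⨅ j, (D.K i j).normalCore := by
  simp only [Subgroup.mem_iInf]
  intro i j y
  -- Fixing the coset of `y⁻¹` means that the conjugate of `x` by `y` lies in `K i j`.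
  have := hx (D.coset i j y⁻¹)
  rw [smul_coset, eq_comm, coset_eq] at this
  simpa [mul_assoc] using this

theorem twoActions_injective : Function.Injective (twoActions B D.X) := by
  rw [injective_iff_map_eq_one]
  intro b hb
  have h1 : ∀ y : D.X, inrHom B b • y = y := fun y =>
    DFunLike.congr_fun (congrArg Prod.fst hb) y
  have h2 : ∀ y : D.X, diagHom B b • y = y := fun y =>
    DFunLike.congr_fun (congrArg Prod.snd hb) y
  exact D.core_trivial.subset ⟨D.mem_iInf_normalCore h1, D.mem_iInf_normalCore h2⟩

end ConstructionData

/-! ### The action of the semidirect product on a given solution -/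

section PermutationBraceAction

variable {B : Type u} [SkewLeftBrace B] {Z : Type v} {t : Z × Z → Z × Z} {h : IsNonDegenerate t}
  (e : permutationGroup h ≃+* B)

theorem toPerm_fst (b : StructureGroup h) : (toPerm h b).1.1 = fHom h b := permHom_fst h b

/-- This combination of the two components factors through the derived group, which is why it is
multiplicative for the star operation. -/
theorem toPerm_snd_mul_fst_inv (b : StructureGroup h) :
    (toPerm h b).1.2 * (toPerm h b).1.1⁻¹ = kap h (cocycleEquiv h b) := by
  rw [toPerm_fst, mul_inv_eq_iff_eq_mul]
  exact permHom_snd h b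

theorem snd_mul_fst_inv_add (p q : permutationGroup h) :
    (p + q).1.2 * (p + q).1.1⁻¹ = p.1.2 * p.1.1⁻¹ * (q.1.2 * q.1.1⁻¹) := by
  obtain ⟨a, rfl⟩ := toPerm_surjective h p
  obtain ⟨b, rfl⟩ := toPerm_surjective h q
  rw [← toPerm_add, toPerm_snd_mul_fst_inv, toPerm_snd_mul_fst_inv, toPerm_snd_mul_fst_inv,
    cocycle_add, map_mul]

theorem ringEquiv_neg (p : permutationGroup h) : e (-p) = -e p := map_neg e.toAddEquiv p

theorem ringEquiv_symm_one : e.symm 1 = 1 := map_one e.symm.toMulEquiv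

/-- The action of `(B, ·) ≅ 𝒢(Z, t)` on `Z` by the first components. -/
noncomputable def fstHom : B →* Equiv.Perm Z where
  toFun b := (e.symm b).1.1
  map_one' := by rw [ringEquiv_symm_one]; rfl
  map_mul' a b := by rw [map_mul]; rfl

/-- The action of `(B, ⋆) ≅ (𝒢(Z, t), ⋆)` on `Z`. -/
noncomputable def starHom : Multiplicative B →* Equiv.Perm Z :=
  MonoidHom.mk' (fun b => (e.symm b.toAdd).1.2 * (e.symm b.toAdd).1.1⁻¹) fun a b => by
    rw [toAdd_mul, map_add, snd_mul_fst_inv_add]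

theorem starHom_apply (b : B) :
    starHom e (Multiplicative.ofAdd b) = (e.symm b).1.2 * (e.symm b).1.1⁻¹ := rfl

/-- Writing `λ_b(a)` as `b^⋆ ⋆ (b · a)`, the second components of `b` cancel and only conjugation by
its first component remains. This is the compatibility needed to glue the two actions. -/
theorem starHom_lamHom (a : Multiplicative B) (b : B) :
    starHom e (lamHom B b a) = fstHom e b * starHom e a * (fstHom e b)⁻¹ := by
  change starHom e (Multiplicative.ofAdd (-b) * Multiplicative.ofAdd (b * a.toAdd)) = _
  rw [map_mul, ofAdd_neg, map_inv, starHom_apply, starHom_apply, map_mul]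
  change _ = (e.symm b).1.1 * ((e.symm a.toAdd).1.2 * (e.symm a.toAdd).1.1⁻¹) *
    (e.symm b).1.1⁻¹
  simp only [Subgroup.coe_mul, Prod.fst_mul, Prod.snd_mul]
  group

/-- The action of `(B, ⋆) ⋊ (B, ·)` on a solution with permutation group isomorphic to `B`. -/
noncomputable def braceActionHom : SemiProd B →* Equiv.Perm Z :=
  SemidirectProduct.lift (starHom e) (fstHom e) fun b =>
    MonoidHom.ext fun a => starHom_lamHom e a b

theorem braceActionHom_pair (a b : B) : braceActionHom e (pair a b) =
    (e.symm a).1.2 * (e.symm a).1.1⁻¹ * (e.symm b).1.1 := rfl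

theorem braceActionHom_inrHom (b : B) : braceActionHom e (inrHom B b) = (e.symm b).1.1 := by
  rw [inrHom_apply, braceActionHom_pair, ringEquiv_symm_one]
  simp

theorem braceActionHom_diagHom (b : B) : braceActionHom e (diagHom B b) = (e.symm b).1.2 := by
  rw [diagHom_apply, braceActionHom_pair, inv_mul_cancel_right]

/-- The map `Z → B` given by the generators of the permutation group. -/
noncomputable def generator (z : Z) : B := e (toPerm h (iG h z))

theorem toPerm_iG (z : Z) : (toPerm h (iG h z)).1 = (f h z, (gt h z)⁻¹) := liftG_iG h _ _ z

theorem iG_fHom (b : StructureGroup h) (z : Z) : iG h (fHom h b z) = -b + b * iG h z := by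
  apply (cocycleEquiv h).injective
  rw [cocycle_add, cocycle_neg, cocycleEquiv_mul, inv_mul_cancel_left]
  change cocycle h _ = lamA h b (cocycle h _)
  rw [cocycle_iG, cocycle_iG, lamA_iA]

/-- Under `φ` this is conjugation of generators in the derived group; with `iG_fHom` it shows that
`Z → B` is equivariant for both factors. -/
theorem iG_kap (b : StructureGroup h) (z : Z) :
    iG h (kap h (cocycleEquiv h b) z) = b + iG h z + -b := by
  apply (cocycleEquiv h).injective
  rw [cocycle_add, cocycle_neg, cocycle_add]
  change cocycle h _ = _ * cocycle h _ * _
  rw [cocycle_iG, cocycle_iG, conj_iA]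

theorem generator_braceActionHom (x : SemiProd B) (z : Z) :
    generator e (braceActionHom e x z) = x • generator e z := by
  have hr : ∀ (b : B) (z : Z),
      generator e (braceActionHom e (pair 1 b) z) = pair 1 b • generator e z := fun b z => by
    obtain ⟨p, rfl⟩ := e.surjective b
    obtain ⟨b, rfl⟩ := toPerm_surjective h p
    rw [← inrHom_apply, braceActionHom_inrHom, e.symm_apply_apply, toPerm_fst, inrHom_smul,
      generator, iG_fHom, toPerm_add, toPerm_neg, map_mul, map_add, ringEquiv_neg, map_mul]
    rfl
  have hl : ∀ (a : B) (z : Z),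
      generator e (braceActionHom e (pair a 1) z) = pair a 1 • generator e z := fun a z => by
    obtain ⟨p, rfl⟩ := e.surjective a
    obtain ⟨a, rfl⟩ := toPerm_surjective h p
    rw [braceActionHom_pair, e.symm_apply_apply, ringEquiv_symm_one, pair_one_right_smul,
      toPerm_snd_mul_fst_inv]
    change generator e (kap h (cocycleEquiv h a) z) = _
    rw [generator, iG_kap, toPerm_add, toPerm_neg, toPerm_add, map_add, map_add,
      ringEquiv_neg]
    rfl
  have hx : x = pair x.left.toAdd 1 * pair 1 x.right := by
    rw [pair_mul_pair, mul_one, one_mul, neg_add_cancel, add_zero]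
    rfl
  rw [hx, map_mul, Equiv.Perm.mul_apply, hl, hr, mul_smul]

/-- A solution with permutation group isomorphic to `B` is recovered from the action of
`(B, ⋆) ⋊ (B, ·)` and the generators. -/
theorem solution_eq (x y : Z) : t (x, y) =
    (braceActionHom e (inrHom B (generator e x)) y,
      braceActionHom e (diagHom B (inrHom B (generator e x) • generator e y))⁻¹ x) := by
  have h1 : braceActionHom e (inrHom B (generator e x)) = f h x := by
    rw [braceActionHom_inrHom, generator, e.symm_apply_apply, toPerm_iG]
  rw [← generator_braceActionHom, h1, map_inv, braceActionHom_diagHom, generator,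
    e.symm_apply_apply, toPerm_iG, inv_inv, gt_f]
  rfl

theorem closure_range_generator : AddSubgroup.closure (Set.range (generator e)) = ⊤ := by
  rw [eq_top_iff]
  intro b _
  obtain ⟨p, rfl⟩ := e.surjective b
  obtain ⟨b, rfl⟩ := toPerm_surjective h p
  let ψ : StructureGroup h →+ B :=
    AddMonoidHom.mk' (fun b => e (toPerm h b)) fun b c => by rw [toPerm_add, map_add]
  change ψ b ∈ _
  -- The star group is the derived group via `φ`, so generation by `X` is proved by induction there.
  obtain ⟨b, rfl⟩ := (cocycleEquiv h).symm.surjective b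
  have hmul : ∀ b c, (cocycleEquiv h).symm (b * c) =
      (cocycleEquiv h).symm b + (cocycleEquiv h).symm c := fun b c => by
    rw [Equiv.symm_apply_eq, cocycle_add, Equiv.apply_symm_apply, Equiv.apply_symm_apply]
  have hone : (cocycleEquiv h).symm 1 = 0 := by
    have := hmul 1 1
    rwa [mul_one, left_eq_add] at this
  have hinv : ∀ b, (cocycleEquiv h).symm b⁻¹ = -(cocycleEquiv h).symm b := fun b => by
    rw [Equiv.symm_apply_eq, cocycle_neg, Equiv.apply_symm_apply]
  refine inductionA h ?_ ?_ ?_ ?_ b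
  · intro x
    have : (cocycleEquiv h).symm (iA h x) = iG h x := by
      rw [Equiv.symm_apply_eq]
      exact (cocycle_iG h x).symm
    rw [this]
    exact AddSubgroup.subset_closure ⟨x, rfl⟩
  · rw [hone, map_zero]
    exact zero_mem _
  · intro b c hb hc
    rw [hmul, map_add]
    exact add_mem hb hc
  · intro b hb
    rw [hinv, map_neg]
    exact neg_mem hb

theorem eq_one_of_braceActionHom_eq_one (b : B) (h1 : braceActionHom e (inrHom B b) = 1)
    (h2 : braceActionHom e (diagHom B b) = 1) : b = 1 := by
  rw [braceActionHom_inrHom] at h1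
  rw [braceActionHom_diagHom] at h2
  have : e.symm b = 1 := Subtype.ext (Prod.ext h1 h2)
  have h3 := congrArg e this
  rw [e.apply_symm_apply] at h3
  rw [h3]
  exact map_one e.toMulEquiv

end PermutationBraceAction

/-! ### Orbit decomposition -/

theorem mk_smul_eq {G : Type u} {Z : Type v} [Group G] [MulAction G Z] (x : G) (z : Z) :
    (Quotient.mk'' (x • z) : MulAction.orbitRel.Quotient G Z) = Quotient.mk'' z :=
  Quotient.sound' (MulAction.orbitRel_apply.2 ⟨x, rfl⟩)

section Decomposition

variable {B : Type u} [SkewLeftBrace B] {a : Orbits B → B} {Z : Type v} [MulAction (SemiProd B) Z]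
  {η : Z → B}

/-- The orbits of `(B, ⋆) ⋊ (B, ·)` on `Z` lying over a given orbit on `B`. -/
def OrbitsOver (η : Z → B) (i : Orbits B) : Type v :=
  {o : MulAction.orbitRel.Quotient (SemiProd B) Z //
    ∃ z, Quotient.mk'' z = o ∧ (Quotient.mk'' (η z) : Orbits B) = i}

theorem OrbitsOver.exists_representative (hη : ∀ (g : SemiProd B) x, η (g • x) = g • η x)
    (ha : ∀ i, a i ∈ i.orbit) {i : Orbits B} (o : OrbitsOver η i) :
    ∃ z, Quotient.mk'' z = o.1 ∧ η z = a i := by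
  obtain ⟨z, hz, hi⟩ := o.2
  have h1 := ha i
  rw [MulAction.orbitRel.Quotient.mem_orbit] at h1
  obtain ⟨x, hx⟩ : a i ∈ MulAction.orbit (SemiProd B) (η z) :=
    MulAction.orbitRel_apply.1 (Quotient.eq''.1 (h1.trans hi.symm))
  exact ⟨x • z, (mk_smul_eq _ _).trans hz, (hη x z).trans hx⟩

/-- A set with an action of `(B, ⋆) ⋊ (B, ·)` and an equivariant map to `B` is a disjoint union of
sets of cosets as in the construction. -/
theorem exists_constructionData [Nonempty Z] (hη : ∀ (g : SemiProd B) x, η (g • x) = g • η x)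
    (ha : ∀ i, a i ∈ i.orbit) (hgen : AddSubgroup.closure (Set.range η) = ⊤)
    (hfaith : ∀ b : B, (∀ z : Z, inrHom B b • z = z) → (∀ z : Z, diagHom B b • z = z) → b = 1) :
    ∃ D : ConstructionData.{u, v} a, Isomorphic D.r (actionSolution η) := by
  -- Base points lie exactly over `a i`, so that equivariance puts their stabilizers inside that of
  -- `a i`.
  choose rep hrep hηrep using
    fun (i : Orbits B) (o : OrbitsOver η i) => o.exists_representative hη ha
  have horb : ∀ z : Z, ∃ (i : Orbits B) (o : OrbitsOver η i) (x : SemiProd B),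
      (Quotient.mk'' (η z) : Orbits B) = i ∧ x • rep i o = z := fun z => by
    let o : OrbitsOver η (Quotient.mk'' (η z)) := ⟨Quotient.mk'' z, z, rfl, rfl⟩
    obtain ⟨x, hx⟩ : z ∈ MulAction.orbit (SemiProd B) (rep _ o) :=
      MulAction.orbitRel_apply.1 (Quotient.eq''.1 (hrep _ o).symm)
    exact ⟨_, o, x, rfl, hx⟩
  let D : ConstructionData.{u, v} a :=
    { I := Set.range fun z => Quotient.mk'' (η z)
      I_nonempty := Set.range_nonempty _
      generates := by
        rw [eq_top_iff, ← hgen]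
        refine AddSubgroup.closure_mono ?_
        rintro _ ⟨z, rfl⟩
        exact Set.mem_biUnion ⟨z, rfl⟩ (MulAction.orbitRel.Quotient.mem_orbit.2 rfl)
      J := fun i => OrbitsOver η i
      J_nonempty := by
        rintro ⟨_, z, rfl⟩
        exact ⟨⟨Quotient.mk'' z, z, rfl, rfl⟩⟩
      K := fun i j => MulAction.stabilizer (SemiProd B) (rep i j)
      K_le := fun i j x hx => by
        rw [MulAction.mem_stabilizer_iff] at hx ⊢
        rw [← hηrep i j, ← hη, hx]
      core_trivial := by
        refine Set.eq_singleton_iff_unique_mem.2 ⟨?_, ?_⟩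
        · have h1 : pair (1 : B) 1 = 1 := map_one (inrHom B)
          rw [Set.mem_ofPred_eq, h1]
          exact ⟨one_mem _, one_mem _⟩
        · rintro b ⟨h1, h2⟩
          -- An element of all the cores fixes every translate of every base point, hence all of
          -- `Z`.
          have key : ∀ y : SemiProd B, (y ∈ ⨅ i : Set.range fun z => (Quotient.mk'' (η z) :
              Orbits B), ⨅ j : OrbitsOver η i,
              (MulAction.stabilizer (SemiProd B) (rep i j)).normalCore) →
              ∀ z : Z, y • z = z := by
            intro y hy z
            obtain ⟨i, o, x, hi, rfl⟩ := horb z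
            simp only [Subgroup.mem_iInf] at hy
            have := hy ⟨i, ⟨_, hi⟩⟩ o x⁻¹
            rw [MulAction.mem_stabilizer_iff, inv_inv, mul_smul, mul_smul,
              inv_smul_eq_iff] at this
            exact this
          exact hfaith b (key _ h1) (key _ h2) }
  -- The orbit-stabilizer bijection on each orbit.
  let F : D.X → Z := fun x => MulAction.ofQuotientStabilizer (SemiProd B) (rep x.1 x.2.1) x.2.2
  have hF : ∀ i j x, F (D.coset i j x) = x • rep i j := fun i j x => rfl
  have hsmul : ∀ x y, F (x • y) = x • F y := fun x y => by
    obtain ⟨i, j, y, rfl⟩ := D.exists_coset y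
    rw [D.smul_coset, hF, hF, mul_smul]
  have heta : ∀ x, η (F x) = D.eta x := fun x => by
    obtain ⟨i, j, y, rfl⟩ := D.exists_coset x
    rw [D.eta_coset, hF, hη, hηrep]
  have hbij : Function.Bijective F := by
    constructor
    · rintro x y hxy
      obtain ⟨⟨i, hi⟩, j, x, rfl⟩ := D.exists_coset x
      obtain ⟨⟨i', hi'⟩, j', y, rfl⟩ := D.exists_coset y
      rw [hF, hF] at hxy
      -- The indices can be read off from the point: `i` is the orbit of its image in `B`, and `j`
      -- is its own orbit in `Z`.
      have hmk : ∀ (x : SemiProd B) i j, (Quotient.mk'' (η (x • rep i j)) : Orbits B) = i :=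
        fun x i j => by
          rw [hη, hηrep]
          exact (mk_smul_eq _ _).trans (MulAction.orbitRel.Quotient.mem_orbit.1 (ha i))
      have hmk2 : ∀ (x : SemiProd B) i j,
          (Quotient.mk'' (x • rep i j) : MulAction.orbitRel.Quotient (SemiProd B) Z) = j.1 :=
        fun x i j => (mk_smul_eq _ _).trans (hrep i j)
      obtain rfl : i = i' := by
        rw [← hmk x i j, ← hmk y i' j', hxy]
      obtain rfl : j = j' := Subtype.ext (by rw [← hmk2 x i j, ← hmk2 y i j', hxy])
      rw [D.coset_eq]
      change _ ∈ MulAction.stabilizer (SemiProd B) _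
      rw [MulAction.mem_stabilizer_iff, mul_smul, inv_smul_eq_iff]
      exact hxy.symm
    · intro z
      obtain ⟨i, o, x, hi, rfl⟩ := horb z
      exact ⟨D.coset ⟨i, ⟨_, hi⟩⟩ o x, rfl⟩
  refine ⟨D, Equiv.ofBijective F hbij, fun x y => ?_⟩
  simp only [Equiv.ofBijective_apply, D.r_eq_actionSolution, actionSolution, Prod.map_apply,
    hsmul, heta]

end Decomposition

end YangBaxter

/-! ### The main theorem -/

theorem mainTheorem1 {B : Type u} [SkewLeftBrace B] (a : SkewLeftBrace.Orbits B → B)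
    (ha : ∀ i, a i ∈ i.orbit) :
    -- the construction gives a non-degenerate solution with permutation group isomorphic to `B`
    (∀ D : YangBaxter.ConstructionData.{u, v} a,
      -- the explicit form of the maps `f` and `g` on cosets
      (∀ (i₁ : D.I) (j₁ : D.J i₁) (b₁ c₁ : B) (i₂ : D.I) (j₂ : D.J i₂) (b₂ c₂ : B),
        let e : B := SkewLeftBrace.pair b₁ c₁ • a i₁
        let w : B := SkewLeftBrace.pair 1 e • SkewLeftBrace.pair b₂ c₂ • a i₂
        D.r (D.coset i₁ j₁ (SkewLeftBrace.pair b₁ c₁), D.coset i₂ j₂ (SkewLeftBrace.pair b₂ c₂)) =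
          (D.coset i₂ j₂ (SkewLeftBrace.pair 1 e * SkewLeftBrace.pair b₂ c₂),
            D.coset i₁ j₁ ((SkewLeftBrace.pair w w)⁻¹ * SkewLeftBrace.pair b₁ c₁))) ∧
      ∃ h : YangBaxter.IsNonDegenerate D.r,
        YangBaxter.BraceIsomorphic (YangBaxter.permutationGroup h) B) ∧
    -- every non-degenerate solution with permutation group isomorphic to `B` arises in this way
    (∀ (Z : Type v) (t : Z × Z → Z × Z) (h : YangBaxter.IsNonDegenerate t),
      YangBaxter.BraceIsomorphic (YangBaxter.permutationGroup h) B →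
        ∃ D : YangBaxter.ConstructionData.{u, v} a, YangBaxter.Isomorphic D.r t) := by
  refine ⟨fun D => ⟨fun _ _ _ _ _ _ _ _ => rfl, ?_⟩, fun Z t h ⟨e⟩ => ?_⟩
  · have := D.nonempty
    have h := YangBaxter.actionSolution_isNonDegenerate D.eta_smul
    exact ⟨h, YangBaxter.permutationGroup_actionSolution h D.eta_smul (D.closure_range_eta ha)
      D.twoActions_injective⟩
  · let : MulAction (SkewLeftBrace.SemiProd B) Z :=
      MulAction.compHom Z (YangBaxter.braceActionHom e)
    have := h.nonempty
    have ht : t = YangBaxter.actionSolution (YangBaxter.generator e) :=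
      funext fun p => YangBaxter.solution_eq e p.1 p.2
    rw [ht]
    exact YangBaxter.exists_constructionData (YangBaxter.generator_braceActionHom e) ha
      (YangBaxter.closure_range_generator e) fun b h1 h2 =>
        YangBaxter.eq_one_of_braceActionHom_eq_one e b (Equiv.ext h1) (Equiv.ext h2)
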